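/- For integers $q\ge 0$, $s_1,\dots,s_q$ and complex numbers $x_1,\dots,x_q$ put $$\mathrm{La}_{s_1,\dots,s_q}(x_1,\dots,x_q)=\sum_{k_1\ge k_2\ge\cdots\ge k_q\ge 1}\frac{x_1^{k_1}\cdots x_q^{k_q}}{k_1^{s_1}\cdots k_q^{s_q}}$$ whenever the series converges absolutely (for $q=0$ this is the constant $1$), and write $(\alpha)_m=\alpha(\alpha+1)\cdots(\alpha+m-1)$. Let $p\ge 1$, let $A_1,\dots,A_p\ge 1$ and $n_1,\dots,n_p\ge 0$ be integers, and let $P\in\mathbb{Q}[X_1,\dots,X_p]$. Then there exist finitely many data consisting of - an integer $q$ with $0\le q\le p$, - integers $s_1,\dots,s_q\ge 1$ with $\sum_{i=1}^q s_i\le\sum_{j=1}^p A_j$, - nonempty subsets $J_1,\dots,J_q$ of $\{1,\dots,p\}$, and - a polynomial $c$ with rational coefficients in the quantities $z_j^{\pm1}$ ($1\le j\le p$) and $(1-z_{j_1}\cdots z_{j_m})^{-1}$ ($m\ge 1$, $1\le j_1<\cdots<j_m\le p$), all depending only on $p$, $P$, $A_1,\dots,A_p$, $n_1,\dots,n_p$,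 such that for all complex numbers $z_1,\dots,z_p$ with $|z_j|>1$ for every $j$ the following holds. The series $$\sum_{k_1\ge\cdots\ge k_p\ge1}\frac{P(k_1,\dots,k_p)}{(k_1)_{n_1+1}^{A_1}\cdots(k_p)_{n_p+1}^{A_p}}\,z_1^{-k_1}\cdots z_p^{-k_p}$$ and all the series $\mathrm{La}_{s_1,\dots,s_q}(1/\widehat z_1,\dots,1/\widehat z_q)$ with $\widehat z_i=\prod_{j\in J_i}z_j$ converge absolutely, and the former is equal to the linear combination of the latter with the values of the corresponding polynomials $c$ as coefficients. -/

import Mathlib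

noncomputable section

namespace MultPolylog

/-- The summation range `k₁ ≥ k₂ ≥ ⋯ ≥ k_p ≥ 1`; for `p = 0` it consists of the empty tuple. -/
def chains (p : ℕ) : Set (Fin p → ℕ) := {k | Antitone k ∧ ∀ i, 1 ≤ k i}

/-- The summand `∏ x_i ^ k_i / k_i ^ s_i` of the large multiple polylogarithm. -/
def laTerm {q : ℕ} (s : Fin q → ℤ) (x : Fin q → ℂ) (k : chains q) : ℂ :=
  ∏ i, x i ^ (k.1 i) / (k.1 i : ℂ) ^ (s i)

/-- The large multiple polylogarithm `La_{s₁,…,s_q}(x₁,…,x_q)`; in depth `0` it equals `1`. -/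
def La {q : ℕ} (s : Fin q → ℤ) (x : Fin q → ℂ) : ℂ := ∑' k : chains q, laTerm s x k

/-- The summand `P(k₁,…,k_p) / ∏ (k_j)_{n_j+1}^{A_j} · ∏ z_j^{-k_j}` of the general multiple
series, where `(α)_m = α(α+1)⋯(α+m-1)`. -/
def seriesTerm {p : ℕ} (P : MvPolynomial (Fin p) ℚ) (A n : Fin p → ℕ) (z : Fin p → ℂ)
    (k : chains p) : ℂ :=
  MvPolynomial.aeval (fun j => (k.1 j : ℂ)) P
    / (∏ j, ((ascPochhammer ℂ (n j + 1)).eval (k.1 j : ℂ)) ^ A j)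
    * ∏ j, z j ^ (-(k.1 j : ℤ))

/-- Names of the quantities in which the coefficients are polynomials. -/
inductive CoeffVar (p : ℕ) : Type
  /-- stands for `z_j` -/
  | var (j : Fin p)
  /-- stands for `z_j⁻¹` -/
  | varInv (j : Fin p)
  /-- stands for `(1 - ∏_{j ∈ J} z_j)⁻¹`, for a nonempty set `J` of indices -/
  | geomInv (J : Finset (Fin p)) (hJ : J.Nonempty)

/-- The value at `z` of the quantity that is named by an element of `CoeffVar p`. -/
def CoeffVar.value {p : ℕ} (z : Fin p → ℂ) : CoeffVar p → ℂ
  | .var j => z j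
  | .varInv j => (z j)⁻¹
  | .geomInv J _ => (1 - ∏ j ∈ J, z j)⁻¹

/-- A depth `q`, exponents `s₁,…,s_q`, and sets `J₁,…,J_q` of indices that encode the products
`∏_{j ∈ J_i} z_j`. -/
structure LaIndex (p : ℕ) : Type where
  depth : ℕ
  exps : Fin depth → ℤ
  blocks : Fin depth → Finset (Fin p)

/-- The arguments `1 / ẑ_i`, where `ẑ_i = ∏_{j ∈ J_i} z_j`. -/
def LaIndex.args {p : ℕ} (t : LaIndex p) (z : Fin p → ℂ) : Fin t.depth → ℂ :=
  fun i => 1 / ∏ j ∈ t.blocks i, z j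

end MultPolylog

end

/-! ### Rational functions of one variable and their partial fractions. -/

namespace MultPolylog

open Polynomial

/-! Truncate the outermost index at `u` and work with functions of `u`, with coefficients in the
ring of formal polynomials. Put `y_j = 1/z_j`, and let `Y` be the product of the `y_j` over a block
of indices. By partial fractions, every summand `ρ(k) Y^k` is a forward difference `G(k+1) - G(k)`,
with `G` of the same shape, plus a combination of pure terms `Y^k / k^s` with `1 ≤ s ≤ w`
(`summands_le_pureSpan_sup`).

A pure term prepends an entry to a polylogarithm. A forward difference is summed by parts
(`partialSum_diff_mul`): this leaves a boundary term with a decaying factor and a nested sum in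
which two neighbouring summands are multiplied. Their disjoint blocks unite, weights add and depth
drops by one. Iterating this from the innermost sum outward (`partialSum_mul_nestedSum_mem`,
`nestedSum_mem_nestedSpan`) yields truncated polylogarithms plus decaying multiples of them; the
latter vanish as `u → ∞` (`nestedSpan_tendsto`). -/

/-- The rational functions `Q / (k)_N ^ w` of `k`, evaluated at `k + 1` for `k : ℕ`. -/
noncomputable def ratFn (w N : ℕ) (Q : ℚ[X]) (k : ℕ) : ℚ :=
  Q.eval ((k : ℚ) + 1) / (ascPochhammer ℚ N).eval ((k : ℚ) + 1) ^ w

/-- All functions `Q / (k)_N ^ w` of weight `w`. -/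
def ratFns (w : ℕ) : Set (ℕ → ℚ) := {ρ | ∃ N Q, ρ = ratFn w N Q}

/-- Partial fractions with poles of order at most `w` at nonpositive integers. -/
noncomputable def partialFracs (w : ℕ) : Submodule ℚ (ℕ → ℚ) :=
  Submodule.span ℚ ({ρ | ∃ a : ℕ, ρ = fun k : ℕ => ((k : ℚ) + 1) ^ a} ∪
    {ρ | ∃ r s : ℕ, 1 ≤ s ∧ s ≤ w ∧ ρ = fun k : ℕ => 1 / ((k : ℚ) + 1 + r) ^ s})

theorem ascPochhammer_eval_add_one_ne_zero (N k : ℕ) :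
    (ascPochhammer ℚ N).eval ((k : ℚ) + 1) ≠ 0 :=
  (ascPochhammer_pos N _ (by positivity)).ne'

theorem polynomial_mem_partialFracs (w : ℕ) (Q : ℚ[X]) :
    (fun k : ℕ => Q.eval ((k : ℚ) + 1)) ∈ partialFracs w := by
  induction Q using Polynomial.induction_on' with
  | add p q hp hq =>
    simp only [eval_add]
    exact add_mem hp hq
  | monomial a c =>
    have h := (partialFracs w).smul_mem c
      (Submodule.subset_span (Or.inl ⟨a, rfl⟩) : (fun k : ℕ => ((k : ℚ) + 1) ^ a) ∈ _)
    convert h using 1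
    funext k
    simp [eval_monomial]

/-- Dividing `Q` by `X + r` splits off the constant `Q(-r)` over the full power; the quotient has a
pole of order one less. -/
theorem pole_mem_partialFracs (w r : ℕ) {s : ℕ} (hs : s ≤ w) (Q : ℚ[X]) :
    (fun k : ℕ => Q.eval ((k : ℚ) + 1) / ((k : ℚ) + 1 + r) ^ s) ∈ partialFracs w := by
  induction s generalizing Q with
  | zero => simpa using polynomial_mem_partialFracs w Q
  | succ s ih =>
    have hQ : ∀ t : ℚ, Q.eval t
        = Q.eval (-(r : ℚ)) + (t + r) * (Q /ₘ (X - C (-(r : ℚ)))).eval t := by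
      intro t
      have h := congrArg (eval t) (modByMonic_add_div Q (X - C (-(r : ℚ))))
      rw [modByMonic_X_sub_C_eq_C_eval] at h
      simpa using h.symm
    have h1 := (partialFracs w).smul_mem (Q.eval (-(r : ℚ)))
      (Submodule.subset_span (Or.inr ⟨r, s + 1, by omega, hs, rfl⟩) :
        (fun k : ℕ => 1 / ((k : ℚ) + 1 + r) ^ (s + 1)) ∈ _)
    convert add_mem h1 (ih (by omega) (Q /ₘ (X - C (-(r : ℚ))))) using 1
    funext k
    have : (k : ℚ) + 1 + r ≠ 0 := by positivity
    simp only [Pi.add_apply, Pi.smul_apply, smul_eq_mul]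
    rw [hQ ((k : ℚ) + 1)]
    field_simp
    ring

/-- The factors of `(X)_N` have roots different from `-N`, so a Bézout identity between the `w`-th
powers of `(X)_N` and `X + N` detaches the last pole without raising its order above `w`. -/
theorem ratFn_mem_partialFracs (w N : ℕ) (Q : ℚ[X]) : ratFn w N Q ∈ partialFracs w := by
  induction N generalizing Q with
  | zero =>
    have h : ratFn w 0 Q = fun k : ℕ => Q.eval ((k : ℚ) + 1) := by
      funext k
      simp [ratFn]
    rw [h]
    exact polynomial_mem_partialFracs w Q
  | succ N ih =>
    have hcop : IsCoprime (ascPochhammer ℚ N) (X + (N : ℚ[X])) := by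
      clear ih
      -- A separate `M` keeps the factor `X + N` fixed during the induction.
      have h : ∀ M ≤ N, IsCoprime (ascPochhammer ℚ M) (X + (N : ℚ[X])) := by
        intro M hM
        induction M with
        | zero => simpa using isCoprime_one_left
        | succ M ih =>
          rw [ascPochhammer_succ_right]
          refine (ih (by omega)).mul_left ?_
          have hne : (-(M : ℚ)) ≠ -(N : ℚ) := by
            intro h
            have : (M : ℚ) = N := by linarith
            have : M = N := by exact_mod_cast this
            omega
          simpa using isCoprime_X_sub_C_of_isUnit_sub (sub_ne_zero.2 hne).isUnit
      exact h N le_rfl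
    obtain ⟨a, b, hab⟩ := hcop.pow (m := w) (n := w)
    convert add_mem (pole_mem_partialFracs w N le_rfl (Q * a)) (ih (Q * b)) using 1
    funext k
    have h1 := ascPochhammer_eval_add_one_ne_zero N k
    have h2 : (k : ℚ) + 1 + N ≠ 0 := by positivity
    have h3 := congrArg (eval ((k : ℚ) + 1)) hab
    simp only [eval_add, eval_mul, eval_pow, eval_X, eval_natCast, eval_one] at h3
    simp only [Pi.add_apply, ratFn, ascPochhammer_succ_right, eval_mul, eval_add, eval_X,
      eval_natCast, mul_pow]
    field_simp
    linear_combination (-eval ((k : ℚ) + 1) Q) * h3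

/-- Expanding by `(k+N)_M ^ w` provides the common denominators needed for products. -/
theorem ratFn_raise (w N M : ℕ) (Q : ℚ[X]) : ∃ Q', ratFn w N Q = ratFn w (N + M) Q' := by
  refine ⟨Q * ((ascPochhammer ℚ M).comp (X + (N : ℚ[X]))) ^ w, ?_⟩
  funext k
  have h1 := ascPochhammer_eval_add_one_ne_zero N k
  have h2 := ascPochhammer_eval_add_one_ne_zero (N + M) k
  rw [← ascPochhammer_mul] at h2
  simp only [ratFn, ← ascPochhammer_mul, eval_mul, eval_pow] at h2 ⊢
  have h3 := right_ne_zero_of_mul h2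
  rw [mul_pow]
  field_simp

theorem ratFns_mul {v w : ℕ} {ρ σ : ℕ → ℚ} (hρ : ρ ∈ ratFns v) (hσ : σ ∈ ratFns w) :
    ρ * σ ∈ ratFns (v + w) := by
  obtain ⟨N, P, rfl⟩ := hρ
  obtain ⟨M, Q, rfl⟩ := hσ
  obtain ⟨P', hP⟩ := ratFn_raise v N M P
  obtain ⟨Q', hQ⟩ := ratFn_raise w M N Q
  rw [hP, hQ, add_comm M N]
  refine ⟨N + M, P' * Q', ?_⟩
  funext k
  simp only [ratFn, Pi.mul_apply, eval_mul, pow_add]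
  rw [div_mul_div_comm]

/-- Since `(x)_{N+1} = x (x+1)_N`, the shifted denominator is `(x)_{N+1} ^ w` up to a factor `x ^
w`, which moves to the numerator. -/
theorem ratFns_shift {w : ℕ} {ρ : ℕ → ℚ} (hρ : ρ ∈ ratFns w) :
    (fun k => ρ (k + 1)) ∈ ratFns w := by
  obtain ⟨N, Q, rfl⟩ := hρ
  refine ⟨N + 1, Q.comp (X + 1) * X ^ w, ?_⟩
  funext k
  have h : (k : ℚ) + 1 ≠ 0 := by positivity
  simp only [ratFn, ascPochhammer_succ_left, eval_mul, eval_comp, eval_pow, eval_X, eval_add,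
    eval_one, mul_pow, Nat.cast_add, Nat.cast_one]
  field_simp

theorem monomial_mem_ratFns (w a : ℕ) : (fun k : ℕ => ((k : ℚ) + 1) ^ a) ∈ ratFns w :=
  ⟨0, X ^ a, by funext k; simp [ratFn]⟩

theorem pole_mem_ratFns {w s : ℕ} (r : ℕ) (hs : s ≤ w) :
    (fun k : ℕ => 1 / ((k : ℚ) + 1 + r) ^ s) ∈ ratFns w := by
  refine ⟨r + 1, ascPochhammer ℚ r ^ w * (X + (r : ℚ[X])) ^ (w - s), ?_⟩
  funext k
  have h1 := ascPochhammer_eval_add_one_ne_zero r k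
  have h2 : (k : ℚ) + 1 + r ≠ 0 := by positivity
  obtain ⟨t, rfl⟩ := Nat.exists_eq_add_of_le hs
  simp only [ratFn, ascPochhammer_succ_right, eval_mul, eval_add, eval_X, eval_pow,
    eval_natCast, Nat.add_sub_cancel_left, mul_pow]
  field_simp
  rw [pow_add]

end MultPolylog
-- Truncated nested sums, summation by parts and reduction to pure terms.
namespace MultPolylog

variable {ι R E : Type*} [CommRing R] [CommRing E] [Algebra R E]

/-- The forward difference. -/
def diff (R : Type*) [CommRing R] [Algebra R E] : (ℕ → E) →ₗ[R] (ℕ → E) where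
  toFun G k := G (k + 1) - G k
  map_add' G H := by funext k; simp only [Pi.add_apply]; ring
  map_smul' c G := by funext k; simp [smul_sub]

/-- Partial sums. -/
def partialSum (R : Type*) [CommRing R] [Algebra R E] : (ℕ → E) →ₗ[R] (ℕ → E) where
  toFun h u := ∑ k ∈ Finset.range (u + 1), h k
  map_add' G H := by funext k; simp [Finset.sum_add_distrib]
  map_smul' c G := by funext k; simp [Finset.smul_sum]

/-- The truncated nested sum `∑_{u ≥ k₁ ≥ ⋯ ≥ k_d} f₁(k₁) ⋯ f_d(k_d)`. -/
def nestedSum {E : Type*} [CommRing E] : List (ℕ → E) → ℕ → E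
  | [] => fun _ => 1
  | f :: l => fun u => ∑ k ∈ Finset.range (u + 1), f k * nestedSum l k

/-- The ring `R` contains the `y j`, their inverses and the inverses of `1 - ∏ j ∈ B, y j`. -/
structure IsCoeffRing (R : Type*) [CommRing R] [Algebra R E] (y : ι → E) : Prop where
  mem (j : ι) : ∃ r : R, algebraMap R E r = y j
  inv (j : ι) : ∃ r : R, algebraMap R E r * y j = 1
  geom (B : Finset ι) : B.Nonempty → ∃ r : R, algebraMap R E r * (1 - ∏ j ∈ B, y j) = 1

theorem IsCoeffRing.prod_mem {y : ι → E} (hy : IsCoeffRing R y) (B : Finset ι) :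
    ∃ r : R, algebraMap R E r = ∏ j ∈ B, y j := by
  choose r hr using hy.mem
  exact ⟨∏ j ∈ B, r j, by simp [hr]⟩

theorem IsCoeffRing.prod_inv {y : ι → E} (hy : IsCoeffRing R y) (B : Finset ι) :
    ∃ r : R, algebraMap R E r * ∏ j ∈ B, y j = 1 := by
  choose r hr using hy.inv
  exact ⟨∏ j ∈ B, r j, by simp [← Finset.prod_mul_distrib, hr]⟩

theorem nestedSum_cons (f : ℕ → E) (l : List (ℕ → E)) :
    nestedSum (f :: l) = partialSum R (f * nestedSum l) := rfl

theorem partialSum_diff (G : ℕ → E) (u : ℕ) : partialSum R (diff R G) u = G (u + 1) - G 0 :=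
  Finset.sum_range_sub G (u + 1)

/-- Summation by parts against a nested sum. -/
theorem partialSum_diff_mul (G f : ℕ → E) (l : List (ℕ → E)) :
    partialSum R (diff R G * nestedSum (f :: l)) =
      (fun u => G (u + 1)) * nestedSum (f :: l) - partialSum R ((G * f) * nestedSum l) := by
  funext u
  simp only [partialSum, diff, nestedSum, LinearMap.coe_mk, AddHom.coe_mk, Pi.mul_apply,
    Pi.sub_apply]
  induction u with
  | zero => simp; ring
  | succ u ih =>
    rw [Finset.sum_range_succ, ih, Finset.sum_range_succ (n := u + 1),
      Finset.sum_range_succ (n := u + 1)]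
    ring

variable [Algebra ℚ E]

/-- The function `k ↦ ρ k * (∏ j ∈ B, y j) ^ (k + 1)`. -/
def blockTerm (y : ι → E) (B : Finset ι) (ρ : ℕ → ℚ) (k : ℕ) : E :=
  algebraMap ℚ E (ρ k) * (∏ j ∈ B, y j) ^ (k + 1)

/-- The function `k ↦ (∏ j ∈ B, y j) ^ (k + 1) / (k + 1) ^ s` for `b = (B, s)`. -/
def pureTerm (y : ι → E) (b : Finset ι × ℕ) : ℕ → E :=
  blockTerm y b.1 fun k => 1 / ((k : ℚ) + 1) ^ b.2

/-- The `R`-span of all `k ↦ ρ k * (∏ j ∈ B, y j) ^ (k + 1)` with `ρ` rational of weight `w`. -/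
def summands (R : Type*) [CommRing R] [Algebra R E] (y : ι → E) (B : Finset ι) (w : ℕ) :
    Submodule R (ℕ → E) :=
  Submodule.span R (blockTerm y B '' ratFns w)

theorem blockTerm_add (y : ι → E) (B : Finset ι) (ρ σ : ℕ → ℚ) :
    blockTerm y B (ρ + σ) = blockTerm y B ρ + blockTerm y B σ := by
  funext k
  simp [blockTerm, add_mul]

/-- Disjointness keeps the product squarefree in the `y j`, so that it is again attached to a set of
indices. -/
theorem blockTerm_mul [DecidableEq ι] (y : ι → E) {B C : Finset ι} (h : Disjoint B C)
    (ρ σ : ℕ → ℚ) : blockTerm y B ρ * blockTerm y C σ = blockTerm y (B ∪ C) (ρ * σ) := by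
  funext k
  simp only [blockTerm, Pi.mul_apply, map_mul, Finset.prod_union h, mul_pow]
  ring

theorem blockTerm_mem_summands {y : ι → E} {B : Finset ι} {w : ℕ} {ρ : ℕ → ℚ}
    (h : ρ ∈ ratFns w) : blockTerm y B ρ ∈ summands R y B w :=
  Submodule.subset_span ⟨ρ, h, rfl⟩

theorem summands_mul [DecidableEq ι] {y : ι → E} {B C : Finset ι} (hBC : Disjoint B C) {v w : ℕ}
    {f g : ℕ → E} (hf : f ∈ summands R y B v) (hg : g ∈ summands R y C w) :
    f * g ∈ summands R y (B ∪ C) (v + w) := by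
  have h := Submodule.mul_mem_mul hf hg
  rw [summands, summands, Submodule.span_mul_span] at h
  refine Submodule.span_mono ?_ h
  rintro _ ⟨_, ⟨ρ, hρ, rfl⟩, _, ⟨σ, hσ, rfl⟩, rfl⟩
  exact ⟨ρ * σ, ratFns_mul hρ hσ, (blockTerm_mul y hBC ρ σ).symm⟩

/-- The span of the pure terms of block `B` and exponents in `[1, w]`. -/
def pureSpan (R : Type*) [CommRing R] [Algebra R E] (y : ι → E) (B : Finset ι) (w : ℕ) :
    Submodule R (ℕ → E) :=
  Submodule.span R {f | ∃ s : ℕ, 1 ≤ s ∧ s ≤ w ∧ f = pureTerm y (B, s)}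

theorem pureTerm_mem_summands {y : ι → E} (b : Finset ι × ℕ) :
    pureTerm y b ∈ summands R y b.1 b.2 :=
  blockTerm_mem_summands (by simpa using pole_mem_ratFns (w := b.2) 0 le_rfl)

theorem summands_shift {y : ι → E} (hy : IsCoeffRing R y) {B : Finset ι} {w : ℕ} {f : ℕ → E}
    (hf : f ∈ summands R y B w) : (fun k => f (k + 1)) ∈ summands R y B w := by
  obtain ⟨r, hr⟩ := hy.prod_mem B
  have h : summands R y B w ≤ (summands R y B w).comap (LinearMap.funLeft R E (· + 1)) := by
    refine Submodule.span_le.2 ?_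
    rintro _ ⟨ρ, hρ, rfl⟩
    have h1 := (summands R y B w).smul_mem r
      (blockTerm_mem_summands (y := y) (B := B) (R := R) (ratFns_shift hρ))
    change LinearMap.funLeft R E (· + 1) (blockTerm y B ρ) ∈ summands R y B w
    convert h1 using 1
    funext k
    simp only [LinearMap.funLeft_apply, blockTerm, Pi.smul_apply, Algebra.smul_def, hr]
    ring
  exact h hf

/-- The difference of the term with pole at `-r` is `Y` times the term with pole at `-(r+1)`, minus
the original term. Since `Y` is invertible in `R`, the pole moves step by step to `0`. -/
theorem pole_mem_pureSpan_sup {y : ι → E} (hy : IsCoeffRing R y) (B : Finset ι) {w s : ℕ}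
    (h1s : 1 ≤ s) (hs : s ≤ w) (r : ℕ) :
    blockTerm y B (fun k : ℕ => 1 / ((k : ℚ) + 1 + r) ^ s) ∈
      pureSpan R y B w ⊔ (summands R y B w).map (diff R) := by
  induction r with
  | zero =>
    refine Submodule.mem_sup_left (Submodule.subset_span ⟨s, h1s, hs, ?_⟩)
    simp [pureTerm]
  | succ r ih =>
    obtain ⟨t, ht⟩ := hy.prod_inv B
    have h1 : diff R (blockTerm y B fun k : ℕ => 1 / ((k : ℚ) + 1 + r) ^ s) ∈
        pureSpan R y B w ⊔ (summands R y B w).map (diff R) :=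
      Submodule.mem_sup_right
        (Submodule.mem_map_of_mem (blockTerm_mem_summands (pole_mem_ratFns r hs)))
    convert Submodule.smul_mem _ t (add_mem h1 ih) using 1
    funext k
    have h2 : ((k + 1 : ℕ) : ℚ) + 1 + r = (k : ℚ) + 1 + (r + 1 : ℕ) := by push_cast; ring
    simp only [Pi.smul_apply, Pi.add_apply, Algebra.smul_def, blockTerm, diff,
      LinearMap.coe_mk, AddHom.coe_mk, sub_add_cancel, h2]
    linear_combination
      (-(algebraMap ℚ E (1 / ((k : ℚ) + 1 + (r + 1 : ℕ)) ^ s) * (∏ j ∈ B, y j) ^ (k + 1))) * ht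

/-- A list of blocks and weights with nonempty disjoint blocks inside `V`, of total weight at most
`W` and length at most `D`. -/
structure Admissible (V : Finset ι) (W D : ℕ) (L : List (Finset ι × ℕ)) : Prop where
  length_le : L.length ≤ D
  sum_le : (L.map Prod.snd).sum ≤ W
  nonempty : ∀ b ∈ L, b.1.Nonempty
  subset : ∀ b ∈ L, b.1 ⊆ V
  disjoint : L.Pairwise fun b c => Disjoint b.1 c.1

theorem Admissible.tail {V : Finset ι} {W D : ℕ} {b : Finset ι × ℕ} {L : List (Finset ι × ℕ)}
    (h : Admissible V W D (b :: L)) : Admissible V W D L where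
  length_le := by have := h.length_le; simp at this; omega
  sum_le := by have := h.sum_le; simp at this; omega
  nonempty c hc := h.nonempty c (List.mem_cons_of_mem _ hc)
  subset c hc := h.subset c (List.mem_cons_of_mem _ hc)
  disjoint := (List.pairwise_cons.1 h.disjoint).2

/-- Reserves the indices, weight and depth of the head, so that it can be put back after the tail
has been replaced by other lists. -/
theorem Admissible.tail_sdiff [DecidableEq ι] {V : Finset ι} {W D : ℕ} {b : Finset ι × ℕ}
    {L : List (Finset ι × ℕ)} (h : Admissible V W D (b :: L)) :
    Admissible (V \ b.1) (W - b.2) (D - 1) L where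
  length_le := by have := h.length_le; simp at this; omega
  sum_le := by have := h.sum_le; simp at this; omega
  nonempty c hc := h.nonempty c (List.mem_cons_of_mem _ hc)
  subset c hc := Finset.subset_sdiff.2 ⟨h.subset c (List.mem_cons_of_mem _ hc),
    ((List.pairwise_cons.1 h.disjoint).1 c hc).symm⟩
  disjoint := (List.pairwise_cons.1 h.disjoint).2

theorem Admissible.cons_of_sdiff [DecidableEq ι] {V : Finset ι} {W D : ℕ} {b : Finset ι × ℕ}
    {L : List (Finset ι × ℕ)} (h : Admissible (V \ b.1) (W - b.2) (D - 1) L)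
    (hne : b.1.Nonempty) (hV : b.1 ⊆ V) (hW : b.2 ≤ W) (hD : 1 ≤ D) :
    Admissible V W D (b :: L) where
  length_le := by have := h.length_le; simp; omega
  sum_le := by have := h.sum_le; simp; omega
  nonempty := by
    simp only [List.mem_cons, forall_eq_or_imp]
    exact ⟨hne, h.nonempty⟩
  subset := by
    simp only [List.mem_cons, forall_eq_or_imp]
    exact ⟨hV, fun c hc => (h.subset c hc).trans Finset.sdiff_subset⟩
  disjoint := List.pairwise_cons.2
    ⟨fun c hc => (Finset.subset_sdiff.1 (h.subset c hc)).2.symm, h.disjoint⟩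

theorem Admissible.congr_weight {V : Finset ι} {W D : ℕ} {B : Finset ι} {s w : ℕ}
    {L : List (Finset ι × ℕ)} (h : Admissible V W D ((B, w) :: L)) (hs : s ≤ w) :
    Admissible V W D ((B, s) :: L) where
  length_le := h.length_le
  sum_le := by have := h.sum_le; simp at this ⊢; omega
  nonempty := by simpa using h.nonempty
  subset := by simpa using h.subset
  disjoint := by simpa using h.disjoint

/-- This is the bookkeeping for multiplying two neighbouring summands. -/
theorem Admissible.merge [DecidableEq ι] {V : Finset ι} {W D : ℕ} {b c : Finset ι × ℕ}
    {L : List (Finset ι × ℕ)} (h : Admissible V W D (b :: c :: L)) :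
    Admissible V W D ((b.1 ∪ c.1, b.2 + c.2) :: L) where
  length_le := by have := h.length_le; simp at this ⊢; omega
  sum_le := by have := h.sum_le; simp at this ⊢; omega
  nonempty := by
    have := h.nonempty
    simp only [List.mem_cons, forall_eq_or_imp] at this ⊢
    exact ⟨this.1.mono Finset.subset_union_left, this.2.2⟩
  subset := by
    have := h.subset
    simp only [List.mem_cons, forall_eq_or_imp] at this ⊢
    exact ⟨Finset.union_subset this.1 this.2.1, this.2.2⟩
  disjoint := by
    have := h.disjoint
    simp only [List.pairwise_cons, List.mem_cons, forall_eq_or_imp] at this ⊢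
    exact ⟨fun d hd => Finset.disjoint_union_left.2 ⟨this.1.2 d hd, this.2.1 d hd⟩, this.2.2⟩

/-- All exponents in the list are positive. -/
def PosExps (L : List (Finset ι × ℕ)) : Prop := ∀ b ∈ L, 1 ≤ b.2

/-- The module of all functions of `u` that are spanned by truncated nested sums of pure terms, up
to products of such a sum with a decaying factor. -/
def nestedSpan (R : Type*) [CommRing R] [Algebra R E] (y : ι → E) (V : Finset ι) (W D : ℕ) :
    Submodule R (ℕ → E) :=
  Submodule.span R
    ({h | ∃ L, PosExps L ∧ Admissible V W D L ∧ h = nestedSum (L.map (pureTerm y))} ∪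
      {h | ∃ B w H L, PosExps L ∧ Admissible V W D ((B, w) :: L) ∧ H ∈ summands R y B w ∧
        h = H * nestedSum (L.map (pureTerm y))})

theorem partialSum_pureSpan_mem {y : ι → E} {V : Finset ι} {W D : ℕ} {B : Finset ι} {w : ℕ}
    {L : List (Finset ι × ℕ)} {f : ℕ → E} (hL : PosExps L)
    (hA : Admissible V W D ((B, w) :: L)) (hf : f ∈ pureSpan R y B w) :
    partialSum R (f * nestedSum (L.map (pureTerm y))) ∈ nestedSpan R y V W D := by
  induction hf using Submodule.span_induction with
  | mem f hf =>
    obtain ⟨s, h1s, hs, rfl⟩ := hf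
    refine Submodule.subset_span (Or.inl ⟨(B, s) :: L, ?_, hA.congr_weight hs, rfl⟩)
    intro b hb
    obtain rfl | hb := List.mem_cons.1 hb
    · exact h1s
    · exact hL b hb
  | zero => simp
  | add f g _ _ hf hg => rw [add_mul, map_add]; exact add_mem hf hg
  | smul c f _ hf => rw [smul_mul_assoc, map_smul]; exact Submodule.smul_mem _ _ hf

variable [Algebra ℚ R]

theorem blockTerm_smul (y : ι → E) (B : Finset ι) (c : ℚ) (ρ : ℕ → ℚ) :
    blockTerm y B (c • ρ) = algebraMap ℚ R c • blockTerm y B ρ := by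
  funext k
  simp [blockTerm, Algebra.smul_def, mul_assoc]

/-- Every value of a summand lies in the image of `R`. -/
theorem summands_apply_mem {y : ι → E} (hy : IsCoeffRing R y) {B : Finset ι} {w : ℕ} {f : ℕ → E}
    (hf : f ∈ summands R y B w) (k : ℕ) : ∃ r : R, algebraMap R E r = f k := by
  obtain ⟨t, ht⟩ := hy.prod_mem B
  induction hf using Submodule.span_induction with
  | mem f hf =>
    obtain ⟨ρ, -, rfl⟩ := hf
    exact ⟨algebraMap ℚ R (ρ k) * t ^ (k + 1), by
      simp [blockTerm, ht]⟩
  | zero => exact ⟨0, by simp⟩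
  | add f g _ _ hf hg =>
    obtain ⟨a, ha⟩ := hf
    obtain ⟨b, hb⟩ := hg
    exact ⟨a + b, by simp [ha, hb]⟩
  | smul c f _ hf =>
    obtain ⟨a, ha⟩ := hf
    exact ⟨c * a, by simp [ha, Algebra.smul_def]⟩

/-- The difference of `(k+1)^a Y^(k+1)` is `(Y - 1)` times itself plus terms of lower degree.
Solving for it is what requires the inverse of `1 - Y`. Polynomial parts thus become pure
differences, so exponent `0` never occurs. -/
theorem monomial_mem_pureSpan_sup {y : ι → E} (hy : IsCoeffRing R y) {B : Finset ι}
    (hB : B.Nonempty) (w a : ℕ) : blockTerm y B (fun k : ℕ => ((k : ℚ) + 1) ^ a) ∈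
      pureSpan R y B w ⊔ (summands R y B w).map (diff R) := by
  induction a using Nat.strong_induction_on with
  | _ a ih =>
    obtain ⟨r, hr⟩ := hy.geom B hB
    obtain ⟨t, ht⟩ := hy.prod_mem B
    have h1 : diff R (blockTerm y B fun k : ℕ => ((k : ℚ) + 1) ^ a) ∈
        pureSpan R y B w ⊔ (summands R y B w).map (diff R) :=
      Submodule.mem_sup_right
        (Submodule.mem_map_of_mem (blockTerm_mem_summands (monomial_mem_ratFns w a)))
    have h2 := Submodule.sum_mem _ fun i (hi : i ∈ Finset.range a) =>
      Submodule.smul_mem _ (algebraMap ℚ R (a.choose i)) (ih i (Finset.mem_range.1 hi))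
    convert Submodule.smul_mem _ r (sub_mem (Submodule.smul_mem _ t h2) h1) using 1
    funext k
    have h3 : ((k : ℚ) + 1 + 1) ^ a
        = ∑ i ∈ Finset.range a, ((k : ℚ) + 1) ^ i * a.choose i + ((k : ℚ) + 1) ^ a := by
      rw [add_pow, Finset.sum_range_succ]
      simp
    simp only [Pi.smul_apply, Pi.sub_apply, Finset.sum_apply]
    simp only [Algebra.smul_def, blockTerm, diff,
      LinearMap.coe_mk, AddHom.coe_mk, ht, ← IsScalarTower.algebraMap_apply, Nat.cast_add,
      Nat.cast_one, h3, map_add, map_sum, map_mul]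
    have h4 : ∑ i ∈ Finset.range a, algebraMap ℚ E (a.choose i) *
        (algebraMap ℚ E (((k : ℚ) + 1) ^ i) * (∏ j ∈ B, y j) ^ (k + 1))
        = (∑ i ∈ Finset.range a, algebraMap ℚ E (((k : ℚ) + 1) ^ i) *
          algebraMap ℚ E (a.choose i)) * (∏ j ∈ B, y j) ^ (k + 1) := by
      rw [Finset.sum_mul]
      exact Finset.sum_congr rfl fun i _ => by ring
    rw [h4]
    linear_combination
      (-(algebraMap ℚ E (((k : ℚ) + 1) ^ a) * (∏ j ∈ B, y j) ^ (k + 1))) * hr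

/-- Modulo forward differences, every summand is a combination of pure terms. -/
theorem summands_le_pureSpan_sup {y : ι → E} (hy : IsCoeffRing R y) {B : Finset ι}
    (hB : B.Nonempty) (w : ℕ) :
    summands R y B w ≤ pureSpan R y B w ⊔ (summands R y B w).map (diff R) := by
  refine Submodule.span_le.2 ?_
  rintro _ ⟨_, ⟨N, Q, rfl⟩, rfl⟩
  have h := ratFn_mem_partialFracs w N Q
  generalize ratFn w N Q = ρ at h
  induction h using Submodule.span_induction with
  | mem ρ hρ =>
    obtain ⟨a, rfl⟩ | ⟨r, s, h1s, hs, rfl⟩ := hρ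
    · exact monomial_mem_pureSpan_sup hy hB w a
    · exact pole_mem_pureSpan_sup hy B h1s hs r
  | zero =>
    have h : blockTerm y B 0 = (0 : ℕ → E) := by
      funext k
      simp [blockTerm]
    rw [h]
    exact Submodule.zero_mem _
  | add ρ σ _ _ hρ hσ => rw [blockTerm_add]; exact add_mem hρ hσ
  | smul c ρ _ hρ => rw [blockTerm_smul (R := R)]; exact Submodule.smul_mem _ _ hρ

/-- Only the difference part `diff R G` of `g` needs work. Against an empty list it telescopes;
otherwise summation by parts multiplies `G` into the head of the list, and the induction applies to
the shorter list. -/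
theorem partialSum_mul_nestedSum_mem [DecidableEq ι] {y : ι → E} (hy : IsCoeffRing R y)
    {V : Finset ι} {W D : ℕ} {B : Finset ι} {w : ℕ} {L : List (Finset ι × ℕ)} {g : ℕ → E}
    (hL : PosExps L) (hA : Admissible V W D ((B, w) :: L)) (hg : g ∈ summands R y B w) :
    partialSum R (g * nestedSum (L.map (pureTerm y))) ∈ nestedSpan R y V W D := by
  induction L generalizing B w g with
  | nil =>
    obtain ⟨f, hf, _, ⟨G, hG, rfl⟩, rfl⟩ :=
      Submodule.mem_sup.1 (summands_le_pureSpan_sup hy (hA.nonempty _ List.mem_cons_self) w hg)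
    rw [add_mul, map_add]
    refine add_mem (partialSum_pureSpan_mem hL hA hf) ?_
    -- The telescoping sum leaves the constant `G 0`, which must be a coefficient from `R`.
    obtain ⟨r, hr⟩ := summands_apply_mem hy hG 0
    have h1 : (fun u => G (u + 1)) * nestedSum (([] : List (Finset ι × ℕ)).map (pureTerm y)) ∈
        nestedSpan R y V W D :=
      Submodule.subset_span (Or.inr ⟨B, w, _, [], hL, hA, summands_shift hy hG, rfl⟩)
    have h2 : nestedSum (([] : List (Finset ι × ℕ)).map (pureTerm y)) ∈ nestedSpan R y V W D :=
      Submodule.subset_span (Or.inl ⟨[], hL, hA.tail, rfl⟩)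
    convert sub_mem h1 (Submodule.smul_mem _ r h2) using 1
    funext u
    have h3 := partialSum_diff (R := R) G u
    have h4 : nestedSum (([] : List (Finset ι × ℕ)).map (pureTerm y)) = 1 := rfl
    rw [h4, mul_one, h3]
    simp [Algebra.smul_def, hr]
  | cons c L ih =>
    obtain ⟨f, hf, _, ⟨G, hG, rfl⟩, rfl⟩ :=
      Submodule.mem_sup.1 (summands_le_pureSpan_sup hy (hA.nonempty _ List.mem_cons_self) w hg)
    rw [add_mul, map_add]
    refine add_mem (partialSum_pureSpan_mem hL hA hf) ?_
    rw [List.map_cons, partialSum_diff_mul]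
    have hBc : Disjoint B c.1 := (List.pairwise_cons.1 hA.disjoint).1 c List.mem_cons_self
    exact sub_mem
      (Submodule.subset_span (Or.inr ⟨B, w, _, c :: L, hL, hA, summands_shift hy hG, rfl⟩))
      (ih (fun b hb => hL b (List.mem_cons_of_mem _ hb)) hA.merge
        (summands_mul hBc hG (pureTerm_mem_summands c)))

/-- The head of the list is the outermost sum, so the induction proceeds from the inside outward. A
decaying factor `H` left by the inner sums is absorbed into the next summand `f`. -/
theorem nestedSum_mem_nestedSpan [DecidableEq ι] {y : ι → E} (hy : IsCoeffRing R y)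
    {V : Finset ι} {W D : ℕ} {bs : List (Finset ι × ℕ)} {fs : List (ℕ → E)}
    (hA : Admissible V W D bs)
    (hfs : List.Forall₂ (fun f (b : Finset ι × ℕ) => f ∈ summands R y b.1 b.2) fs bs) :
    nestedSum fs ∈ nestedSpan R y V W D := by
  induction hfs generalizing V W D with
  | nil => exact Submodule.subset_span (Or.inl ⟨[], by simp [PosExps], hA, rfl⟩)
  | @cons f b fs bs hf _ ih =>
    have hne := hA.nonempty _ List.mem_cons_self
    have hV := hA.subset _ List.mem_cons_self
    have hW : b.2 ≤ W := by have := hA.sum_le; simp at this; omega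
    have hD : 1 ≤ D := by have := hA.length_le; simp at this; omega
    have h := ih hA.tail_sdiff
    rw [nestedSum_cons (R := R)]
    generalize nestedSum fs = h' at h
    induction h using Submodule.span_induction with
    | mem h hh =>
      obtain ⟨L, hL, hA', rfl⟩ | ⟨C, w, H, L, hL, hA', hH, rfl⟩ := hh
      · exact partialSum_mul_nestedSum_mem hy hL (hA'.cons_of_sdiff hne hV hW hD) hf
      · rw [← mul_assoc]
        have hA'' := hA'.cons_of_sdiff hne hV hW hD
        exact partialSum_mul_nestedSum_mem hy hL hA''.merge
          (summands_mul ((List.pairwise_cons.1 hA''.disjoint).1 _ List.mem_cons_self) hf hH)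
    | zero => simp
    | add g h _ _ hg hh => rw [mul_add, map_add]; exact add_mem hg hh
    | smul c h _ hh => rw [mul_smul_comm, map_smul]; exact Submodule.smul_mem _ _ hh

end MultPolylog
-- Absolute convergence and passage to the limit.
namespace MultPolylog

open Filter Topology

theorem antitone_cons_iff {p : ℕ} {k : ℕ} {t : Fin p → ℕ} :
    Antitone (Fin.cons k t : Fin (p + 1) → ℕ) ↔ Antitone t ∧ ∀ i, t i ≤ k := by
  constructor
  · intro h
    refine ⟨fun i j hij => ?_, fun i => ?_⟩
    · simpa using h (Fin.succ_le_succ_iff.2 hij)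
    · simpa using h (Fin.zero_le i.succ)
  · rintro ⟨h1, h2⟩ i j hij
    refine Fin.cases (fun hij => ?_) (fun i hij => ?_) i hij
    · refine Fin.cases ?_ (fun j => ?_) j
      · simp
      · simpa using h2 j
    · revert hij
      refine Fin.cases (fun hij => ?_) (fun j hij => ?_) j
      · simp at hij
      · simpa using h1 (Fin.succ_le_succ_iff.1 hij)

theorem nestedSum_ofFn {p : ℕ} (f : Fin p → ℕ → ℂ) (u : ℕ) :
    nestedSum (List.ofFn f) u =
      ∑ t ∈ Fintype.piFinset fun _ : Fin p => Finset.range (u + 1),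
        {t : Fin p → ℕ | Antitone t}.indicator (fun t => ∏ j, f j (t j)) t := by
  classical
  induction p generalizing u with
  | zero =>
    have : Antitone (default : Fin 0 → ℕ) := fun i => i.elim0
    simp [nestedSum, Set.indicator, Subsingleton.antitone]
  | succ p ih =>
    rw [List.ofFn_succ]
    simp only [nestedSum, ih, Set.indicator_apply, Set.mem_ofPred_eq, ← Finset.sum_filter,
      Finset.mul_sum]
    rw [Finset.sum_sigma']
    refine Finset.sum_bij' (fun x _ => (Fin.cons x.1 x.2 : Fin (p + 1) → ℕ))
      (fun t _ => ⟨t 0, Fin.tail t⟩) ?_ ?_ ?_ ?_ ?_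
    · rintro ⟨k, t⟩ h
      simp only [Finset.mem_sigma, Finset.mem_range, Finset.mem_filter,
        Fintype.mem_piFinset] at h ⊢
      refine ⟨fun i => ?_, antitone_cons_iff.2 ⟨h.2.2, fun i => by have := h.2.1 i; omega⟩⟩
      refine Fin.cases ?_ (fun i => ?_) i
      · simpa using h.1
      · have := h.2.1 i
        simp only [Fin.cons_succ]
        omega
    · intro t h
      simp only [Finset.mem_sigma, Finset.mem_range, Finset.mem_filter,
        Fintype.mem_piFinset] at h ⊢
      have h2 := h.2
      rw [← Fin.cons_self_tail t, antitone_cons_iff] at h2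
      exact ⟨h.1 0, fun i => by have := h2.2 i; omega, h2.1⟩
    · rintro ⟨k, t⟩ _
      simp
    · intro t _
      simp
    · rintro ⟨k, t⟩ _
      simp [Fin.prod_univ_succ]

theorem summable_norm_prod {p : ℕ} {f : Fin p → ℕ → ℂ} (hf : ∀ j, Summable fun k => ‖f j k‖) :
    Summable fun t : Fin p → ℕ => ‖∏ j, f j (t j)‖ := by
  induction p with
  | zero => exact (hasSum_fintype _).summable
  | succ p ih =>
    have h := (hf 0).mul_norm (ih fun j => hf j.succ)
    rw [← (Fin.consEquiv fun _ : Fin (p + 1) => ℕ).summable_iff]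
    refine h.congr fun x => ?_
    simp [Fin.prod_univ_succ, Fin.consEquiv]

/-- A nested series of absolutely summable functions converges absolutely. -/
theorem summable_antitone {p : ℕ} {f : Fin p → ℕ → ℂ} (hf : ∀ j, Summable fun k => ‖f j k‖) :
    Summable fun t : {t : Fin p → ℕ // Antitone t} => ∏ j, f j (t.1 j) :=
  (summable_norm_prod hf).of_norm.comp_injective Subtype.val_injective

/-- Truncated sums are sums over the antitone tuples in the boxes `[0, u]^p`, and these boxes
exhaust all tuples. -/
theorem tendsto_nestedSum_ofFn {p : ℕ} {f : Fin p → ℕ → ℂ}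
    (hf : ∀ j, Summable fun k => ‖f j k‖) :
    Tendsto (nestedSum (List.ofFn f)) atTop
      (𝓝 (∑' t : {t : Fin p → ℕ // Antitone t}, ∏ j, f j (t.1 j))) := by
  classical
  have h := (summable_antitone hf).hasSum
  have h1 : HasSum ({t : Fin p → ℕ | Antitone t}.indicator fun t => ∏ j, f j (t j)) _ :=
    hasSum_subtype_iff_indicator.1 h
  have h2 : Tendsto (fun u : ℕ => Fintype.piFinset fun _ : Fin p => Finset.range (u + 1))
      atTop atTop := by
    refine tendsto_atTop_finset_of_monotone (fun u v huv => ?_) fun t => ?_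
    · exact Fintype.piFinset_subset _ _ fun _ => Finset.range_mono (by omega)
    · refine ⟨∑ j, t j, ?_⟩
      simp only [Fintype.mem_piFinset, Finset.mem_range]
      intro i
      have := Finset.single_le_sum (f := t) (fun j _ => Nat.zero_le _) (Finset.mem_univ i)
      omega
  refine (h1.comp h2).congr fun u => ?_
  exact (nestedSum_ofFn f u).symm

/-- Reindexing of chains of positive integers by chains of natural numbers. -/
def antitoneEquivChains (p : ℕ) : {t : Fin p → ℕ // Antitone t} ≃ chains p where
  toFun t := ⟨fun i => t.1 i + 1, fun _ _ h => Nat.succ_le_succ (t.2 h), fun _ => by simp⟩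
  invFun k := ⟨fun i => k.1 i - 1, fun _ _ h => Nat.sub_le_sub_right (k.2.1 h) 1⟩
  left_inv t := by simp
  right_inv k := by
    ext i
    exact Nat.sub_add_cancel (k.2.2 i)

theorem map_nestedSum {E F : Type*} [CommRing E] [CommRing F] (φ : E →+* F) (l : List (ℕ → E))
    (u : ℕ) : φ (nestedSum l u) = nestedSum (l.map fun f k => φ (f k)) u := by
  induction l generalizing u with
  | nil => simp [nestedSum]
  | cons f l ih => simp [nestedSum, ih]

theorem norm_prod_lt_one {ι : Type*} {x : ι → ℂ} (hx : ∀ j, ‖x j‖ < 1) {B : Finset ι}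
    (hB : B.Nonempty) : ‖∏ j ∈ B, x j‖ < 1 := by
  rw [norm_prod]
  by_cases h : ∃ j ∈ B, x j = 0
  · obtain ⟨j, hj, h0⟩ := h
    rw [Finset.prod_eq_zero hj (by simp [h0])]
    exact one_pos
  · push Not at h
    calc ∏ j ∈ B, ‖x j‖ < ∏ j ∈ B, 1 :=
          Finset.prod_lt_prod_of_nonempty (fun j hj => norm_pos_iff.2 (h j hj))
            (fun j _ => hx j) hB
      _ = 1 := by simp

/-- Partial fractions reduce this to powers of `k + 1` times a geometric sequence of ratio less than
`1` in norm; terms with poles are dominated by the geometric sequence itself. -/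
theorem summable_norm_blockTerm {ι : Type*} {x : ι → ℂ} (hx : ∀ j, ‖x j‖ < 1) {B : Finset ι}
    (hB : B.Nonempty) {w : ℕ} {ρ : ℕ → ℚ} (hρ : ρ ∈ partialFracs w) :
    Summable fun k => ‖blockTerm x B ρ k‖ := by
  have hmon : ∀ a : ℕ,
      Summable fun k => ‖blockTerm x B (fun k : ℕ => ((k : ℚ) + 1) ^ a) k‖ := by
    intro a
    have h := (summable_nat_add_iff 1).2
      (summable_norm_pow_mul_geometric_of_norm_lt_one a (norm_prod_lt_one hx hB))
    simpa [blockTerm] using h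
  induction hρ using Submodule.span_induction with
  | mem ρ hρ =>
    obtain ⟨a, rfl⟩ | ⟨r, s, -, -, rfl⟩ := hρ
    · exact hmon a
    · refine (hmon 0).of_nonneg_of_le (fun _ => norm_nonneg _) fun k => ?_
      simp only [blockTerm, norm_mul, pow_zero, map_one, norm_one]
      refine mul_le_mul_of_nonneg_right ?_ (norm_nonneg _)
      have h1 : (1 : ℝ) ≤ (k : ℝ) + 1 + r := by
        have := Nat.cast_nonneg (α := ℝ) k
        have := Nat.cast_nonneg (α := ℝ) r
        linarith
      have h2 : ‖(k : ℂ) + 1 + r‖ = (k : ℝ) + 1 + r := by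
        exact_mod_cast Complex.norm_natCast (k + 1 + r)
      simp only [eq_ratCast, Rat.cast_div, Rat.cast_one, Rat.cast_pow, Rat.cast_add,
        Rat.cast_natCast, norm_div, norm_one, norm_pow, h2]
      exact (div_le_one (by positivity)).2 (one_le_pow₀ h1)
  | zero => simp [blockTerm]
  | add ρ σ _ _ hρ hσ =>
    refine (hρ.add hσ).of_nonneg_of_le (fun _ => norm_nonneg _) fun k => ?_
    rw [blockTerm_add]
    exact norm_add_le _ _
  | smul c ρ _ hρ =>
    simpa [blockTerm, mul_assoc] using hρ.mul_left ‖(c : ℂ)‖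

end MultPolylog
-- Specialization to functions on the domain `|z_j| > 1`.
namespace MultPolylog

open Filter Topology Polynomial

/-- The domain of the points `z` with `|z_j| > 1` for all `j`. -/
abbrev Region (p : ℕ) : Type := {z : Fin p → ℂ // ∀ j, 1 < ‖z j‖}

/-- Formal polynomials act on functions of `z` through their values. Working with all `z` at once
makes the resulting coefficients independent of `z`. -/
noncomputable instance coeffAlgebra (p : ℕ) :
    Algebra (MvPolynomial (CoeffVar p) ℚ) (Region p → ℂ) :=
  (MvPolynomial.aeval fun (v : CoeffVar p) (z : Region p) => v.value z.1).toRingHom.toAlgebra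

theorem coeffAlgebra_apply {p : ℕ} (f : MvPolynomial (CoeffVar p) ℚ) (z : Region p) :
    algebraMap (MvPolynomial (CoeffVar p) ℚ) (Region p → ℂ) f z =
      MvPolynomial.aeval (CoeffVar.value z.1) f := by
  have h : (Pi.evalAlgHom ℚ (fun _ : Region p => ℂ) z).comp
      (MvPolynomial.aeval fun (v : CoeffVar p) (z : Region p) => v.value z.1) =
      MvPolynomial.aeval (CoeffVar.value z.1) :=
    MvPolynomial.algHom_ext fun v => by simp
  exact DFunLike.congr_fun h f

/-- The functions `z ↦ 1 / z_j`. -/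
noncomputable def invCoord (p : ℕ) (j : Fin p) (z : Region p) : ℂ := (z.1 j)⁻¹

theorem norm_invCoord_lt_one {p : ℕ} (z : Region p) (j : Fin p) : ‖invCoord p j z‖ < 1 := by
  rw [invCoord, norm_inv]
  exact inv_lt_one_of_one_lt₀ (z.2 j)

theorem Region.ne_zero {p : ℕ} (z : Region p) (j : Fin p) : z.1 j ≠ 0 :=
  norm_pos_iff.1 (one_pos.trans (z.2 j))

theorem isCoeffRing_invCoord (p : ℕ) :
    IsCoeffRing (MvPolynomial (CoeffVar p) ℚ) (invCoord p) where
  mem j := ⟨MvPolynomial.X (.varInv j), by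
    funext z
    simp [coeffAlgebra_apply, CoeffVar.value, invCoord]⟩
  inv j := ⟨MvPolynomial.X (.var j), by
    funext z
    simp [coeffAlgebra_apply, CoeffVar.value, invCoord, z.ne_zero j]⟩
  -- With `Z = ∏ z_j`, this is `1 / (1 - 1/Z) = -Z / (1 - Z)`.
  geom B hB := ⟨-(∏ j ∈ B, MvPolynomial.X (.var j)) * MvPolynomial.X (.geomInv B hB), by
    funext z
    have h0 : ∏ j ∈ B, z.1 j ≠ 0 := Finset.prod_ne_zero_iff.2 fun j _ => z.ne_zero j
    have h1 : 1 - ∏ j ∈ B, z.1 j ≠ 0 := by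
      intro h
      have h2 := norm_prod_lt_one (norm_invCoord_lt_one z) hB
      simp [invCoord, Finset.prod_inv_distrib, ← sub_eq_zero.1 h] at h2
    rw [Pi.mul_apply, coeffAlgebra_apply]
    simp only [map_mul, map_neg, map_prod,
      MvPolynomial.aeval_X, CoeffVar.value, Pi.sub_apply, Pi.one_apply, Finset.prod_apply,
      invCoord, Finset.prod_inv_distrib]
    field_simp
    ring⟩

/-- The index that a list of blocks and exponents encodes. -/
def toLaIndex {p : ℕ} (L : List (Finset (Fin p) × ℕ)) : LaIndex p where
  depth := L.length
  exps i := (L.get i).2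
  blocks i := (L.get i).1

theorem laTerm_toLaIndex {p : ℕ} (L : List (Finset (Fin p) × ℕ)) (z : Region p)
    (t : {t : Fin L.length → ℕ // Antitone t}) :
    laTerm (toLaIndex L).exps ((toLaIndex L).args z.1) (antitoneEquivChains _ t) =
      ∏ i, pureTerm (fun j => invCoord p j z) (L.get i) (t.1 i) := by
  refine Finset.prod_congr rfl fun i _ => ?_
  change (1 / ∏ j ∈ (L.get i).1, z.1 j) ^ (t.1 i + 1) /
    ((t.1 i + 1 : ℕ) : ℂ) ^ ((L.get i).2 : ℤ) = _
  simp only [pureTerm, blockTerm, invCoord, Finset.prod_inv_distrib, zpow_natCast, eq_ratCast]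
  push_cast
  ring

theorem summable_norm_pureTerm {p : ℕ} (z : Region p) {b : Finset (Fin p) × ℕ}
    (hb : b.1.Nonempty) : Summable fun k => ‖pureTerm (fun j => invCoord p j z) b k‖ := by
  obtain ⟨N, Q, h⟩ := pole_mem_ratFns (w := b.2) 0 le_rfl
  refine summable_norm_blockTerm (norm_invCoord_lt_one z) hb (w := b.2) ?_
  have h1 := ratFn_mem_partialFracs b.2 N Q
  rw [← h] at h1
  simpa using h1

theorem summable_laTerm_toLaIndex {p : ℕ} {L : List (Finset (Fin p) × ℕ)}
    (hL : ∀ b ∈ L, b.1.Nonempty) (z : Region p) :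
    Summable (laTerm (toLaIndex L).exps ((toLaIndex L).args z.1)) := by
  refine (antitoneEquivChains _).summable_iff.1 ?_
  refine (summable_antitone (f := fun i => pureTerm (fun j => invCoord p j z) (L.get i))
    fun i => summable_norm_pureTerm z (hL _ (List.get_mem L i))).congr fun t => ?_
  exact (laTerm_toLaIndex L z t).symm

theorem blockTerm_apply {p : ℕ} (B : Finset (Fin p)) (ρ : ℕ → ℚ) (k : ℕ) (z : Region p) :
    blockTerm (invCoord p) B ρ k z = blockTerm (fun j => invCoord p j z) B ρ k := by
  simp [blockTerm]

theorem nestedSum_apply {p : ℕ} (l : List (ℕ → Region p → ℂ)) (u : ℕ) (z : Region p) :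
    nestedSum l u z = nestedSum (l.map fun f k => f k z) u :=
  map_nestedSum (Pi.evalRingHom (fun _ : Region p => ℂ) z) l u

theorem tendsto_nestedSum_pureTerm {p : ℕ} {L : List (Finset (Fin p) × ℕ)}
    (hL : ∀ b ∈ L, b.1.Nonempty) (z : Region p) :
    Tendsto (fun u => nestedSum (L.map (pureTerm (invCoord p))) u z) atTop
      (𝓝 (La (toLaIndex L).exps ((toLaIndex L).args z.1))) := by
  have h := tendsto_nestedSum_ofFn
    (f := fun i => pureTerm (fun j => invCoord p j z) (L.get i))
    fun i => summable_norm_pureTerm z (hL _ (List.get_mem L i))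
  have hLa : La (toLaIndex L).exps ((toLaIndex L).args z.1) =
      ∑' t : {t : Fin L.length → ℕ // Antitone t},
        ∏ i, pureTerm (fun j => invCoord p j z) (L.get i) (t.1 i) :=
    ((antitoneEquivChains _).tsum_eq _).symm.trans (tsum_congr (laTerm_toLaIndex L z))
  rw [hLa]
  refine h.congr fun u => ?_
  rw [nestedSum_apply, List.map_map]
  congr 1
  refine List.ext_get (by simp) fun i h1 h2 => ?_
  funext k
  simp [pureTerm, blockTerm_apply]

theorem summands_tendsto_zero {p : ℕ} {B : Finset (Fin p)} (hB : B.Nonempty) {w : ℕ}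
    {H : ℕ → Region p → ℂ}
    (hH : H ∈ summands (MvPolynomial (CoeffVar p) ℚ) (invCoord p) B w) (z : Region p) :
    Tendsto (fun u => H u z) atTop (𝓝 0) := by
  induction hH using Submodule.span_induction with
  | mem H hH =>
    obtain ⟨_, ⟨N, Q, rfl⟩, rfl⟩ := hH
    simp only [blockTerm_apply]
    exact tendsto_zero_iff_norm_tendsto_zero.2 (summable_norm_blockTerm (norm_invCoord_lt_one z)
      hB (ratFn_mem_partialFracs w N Q)).tendsto_atTop_zero
  | zero => simp
  | add f g _ _ hf hg => simpa using hf.add hg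
  | smul c f _ hf =>
    simpa [Algebra.smul_def] using
      hf.const_mul (algebraMap (MvPolynomial (CoeffVar p) ℚ) (Region p → ℂ) c z)

/-- The large multiple polylogarithm of an index, as a function of `z`. -/
noncomputable def laFun {p : ℕ} (t : LaIndex p) (z : Region p) : ℂ := La t.exps (t.args z.1)

/-- The indices of weight at most `W` and depth at most `D` with nonempty disjoint blocks. -/
def laIndices (p W D : ℕ) : Set (LaIndex p) :=
  {t | ∃ L, PosExps L ∧ Admissible Finset.univ W D L ∧ t = toLaIndex L}

/-- Pure nested sums tend to polylogarithms, whereas products with a decaying factor tend to `0`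
because the accompanying nested sum converges. -/
theorem nestedSpan_tendsto {p W D : ℕ} {h : ℕ → Region p → ℂ}
    (hh : h ∈ nestedSpan (MvPolynomial (CoeffVar p) ℚ) (invCoord p) Finset.univ W D) :
    ∃ g ∈ Submodule.span (MvPolynomial (CoeffVar p) ℚ) (laFun '' laIndices p W D),
      ∀ z, Tendsto (fun u => h u z) atTop (𝓝 (g z)) := by
  induction hh using Submodule.span_induction with
  | mem h hh =>
    obtain ⟨L, hL, hA, rfl⟩ | ⟨B, w, H, L, hL, hA, hH, rfl⟩ := hh
    · exact ⟨laFun (toLaIndex L), Submodule.subset_span ⟨_, ⟨L, hL, hA, rfl⟩, rfl⟩,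
        fun z => tendsto_nestedSum_pureTerm hA.nonempty z⟩
    · refine ⟨0, zero_mem _, fun z => ?_⟩
      simpa using (summands_tendsto_zero (hA.nonempty _ List.mem_cons_self) hH z).mul
        (tendsto_nestedSum_pureTerm hA.tail.nonempty z)
  | zero => exact ⟨0, zero_mem _, fun z => by simp⟩
  | add f g _ _ hf hg =>
    obtain ⟨a, ha, hf⟩ := hf
    obtain ⟨b, hb, hg⟩ := hg
    exact ⟨a + b, add_mem ha hb, fun z => (hf z).add (hg z)⟩
  | smul c f _ hf =>
    obtain ⟨a, ha, hf⟩ := hf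
    refine ⟨c • a, Submodule.smul_mem _ c ha, fun z => ?_⟩
    simpa [Algebra.smul_def] using
      (hf z).const_mul (algebraMap (MvPolynomial (CoeffVar p) ℚ) (Region p → ℂ) c z)

theorem admissible_ofFn {p : ℕ} (A : Fin p → ℕ) : Admissible Finset.univ (∑ j, A j) p
    (List.ofFn fun j : Fin p => (({j} : Finset (Fin p)), A j)) where
  length_le := by simp
  sum_le := by simp [List.map_ofFn, List.sum_ofFn]
  nonempty := by simp [List.mem_ofFn]
  subset := by simp
  disjoint := List.pairwise_ofFn.2 fun i j hij => by simpa using hij.ne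

theorem seriesTerm_monomial {p : ℕ} (m : Fin p →₀ ℕ) (a : ℚ) (A n : Fin p → ℕ) (z : Region p)
    (t : {t : Fin p → ℕ // Antitone t}) :
    seriesTerm (MvPolynomial.monomial m a) A n z.1 (antitoneEquivChains p t) =
      a * ∏ j, blockTerm (fun j => invCoord p j z) {j}
        (ratFn (A j) (n j + 1) (X ^ m j)) (t.1 j) := by
  have h (N k : ℕ) : (((ascPochhammer ℚ N).eval ((k : ℚ) + 1) : ℚ) : ℂ)
      = (ascPochhammer ℂ N).eval ((k : ℂ) + 1) := by
    have h1 := eval₂_at_apply (p := ascPochhammer ℚ N) (algebraMap ℚ ℂ) ((k : ℚ) + 1)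
    rw [← ascPochhammer_eval₂] at h1
    simpa using h1.symm
  simp only [seriesTerm, antitoneEquivChains, Equiv.coe_fn_mk, MvPolynomial.aeval_monomial,
    Finsupp.prod_fintype _ _ fun _ => pow_zero _, eq_ratCast, blockTerm, ratFn, eval_pow, eval_X,
    Finset.prod_singleton, Rat.cast_div, Rat.cast_pow, h, Rat.cast_add, Rat.cast_natCast,
    Rat.cast_one, Finset.prod_mul_distrib, Finset.prod_div_distrib, invCoord, Nat.cast_add,
    Nat.cast_one, inv_pow, zpow_neg, ← mul_assoc, mul_div_assoc]
  norm_cast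

/-- For a monomial `P` the summand is a product of one-variable functions, initially with the
singleton blocks `{j}` and weights `A j`; general `P` follows by linearity. -/
theorem hasSum_seriesTerm {p : ℕ} (P : MvPolynomial (Fin p) ℚ) (A n : Fin p → ℕ) :
    ∃ g ∈ Submodule.span (MvPolynomial (CoeffVar p) ℚ) (laFun '' laIndices p (∑ j, A j) p),
      ∀ z : Region p, HasSum (seriesTerm P A n z.1) (g z) := by
  induction P using MvPolynomial.induction_on' with
  | monomial m a =>
    set ρ : Fin p → ℕ → ℚ := fun j => ratFn (A j) (n j + 1) (X ^ m j) with hρ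
    have h1 : nestedSum (List.ofFn fun j : Fin p => blockTerm (invCoord p) {j} (ρ j)) ∈
        nestedSpan (MvPolynomial (CoeffVar p) ℚ) (invCoord p) Finset.univ (∑ j, A j) p := by
      refine nestedSum_mem_nestedSpan (isCoeffRing_invCoord p) (admissible_ofFn A)
        (List.forall₂_iff_get.2 ⟨by simp, fun i h1 h2 => ?_⟩)
      simpa using blockTerm_mem_summands ⟨_, _, rfl⟩
    obtain ⟨g, hg, hlim⟩ := nestedSpan_tendsto h1
    refine ⟨(MvPolynomial.C a : MvPolynomial (CoeffVar p) ℚ) • g, Submodule.smul_mem _ _ hg,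
      fun z => ?_⟩
    have hs (j : Fin p) :
        Summable fun k => ‖blockTerm (fun j => invCoord p j z) {j} (ρ j) k‖ :=
      summable_norm_blockTerm (norm_invCoord_lt_one z) (Finset.singleton_nonempty j)
        (ratFn_mem_partialFracs _ _ _)
    have h2 := tendsto_nestedSum_ofFn hs
    have h3 := hlim z
    simp only [nestedSum_apply, List.map_ofFn, Function.comp_def, blockTerm_apply] at h3
    -- The same truncated sums converge both to the algebraic expression `g z` and to the infinite
    -- series.
    have h4 := tendsto_nhds_unique h3 h2
    rw [← (antitoneEquivChains p).hasSum_iff]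
    have h5 := ((summable_antitone hs).hasSum.mul_left (a : ℂ))
    rw [← h4] at h5
    rw [Algebra.smul_def, Pi.mul_apply, coeffAlgebra_apply, MvPolynomial.aeval_C,
      eq_ratCast (algebraMap ℚ ℂ), funext (f := _ ∘ _) (seriesTerm_monomial m a A n z)]
    exact h5
  | add P Q hP hQ =>
    obtain ⟨f, hf, hP⟩ := hP
    obtain ⟨g, hg, hQ⟩ := hQ
    refine ⟨f + g, add_mem hf hg, fun z => ?_⟩
    have h : seriesTerm (P + Q) A n z.1 =
        fun k => seriesTerm P A n z.1 k + seriesTerm Q A n z.1 k := by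
      funext k
      simp [seriesTerm, add_div, add_mul]
    rw [h]
    exact (hP z).add (hQ z)

end MultPolylog

theorem mainTheorem3 (p : ℕ) (hp : 1 ≤ p) (P : MvPolynomial (Fin p) ℚ) (A n : Fin p → ℕ)
    (hA : ∀ j, 1 ≤ A j) :
    ∃ c : MultPolylog.LaIndex p →₀ MvPolynomial (MultPolylog.CoeffVar p) ℚ,
      (∀ t ∈ c.support,
        t.depth ≤ p ∧ (∀ i, 1 ≤ t.exps i) ∧ (∑ i, t.exps i ≤ ∑ j, (A j : ℤ)) ∧
          ∀ i, (t.blocks i).Nonempty) ∧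
      ∀ z : Fin p → ℂ, (∀ j, 1 < ‖z j‖) →
        (∀ t ∈ c.support, Summable (MultPolylog.laTerm t.exps (t.args z))) ∧
        HasSum (MultPolylog.seriesTerm P A n z)
          (c.sum fun t f =>
            MvPolynomial.aeval (MultPolylog.CoeffVar.value z) f *
              MultPolylog.La t.exps (t.args z)) := by
  obtain ⟨g, hg, hsum⟩ := MultPolylog.hasSum_seriesTerm P A n
  obtain ⟨c, hc, rfl⟩ := (Finsupp.mem_span_image_iff_linearCombination _).1 hg
  rw [Finsupp.mem_supported] at hc
  refine ⟨c, fun t ht => ?_, fun z hz => ⟨fun t ht => ?_, ?_⟩⟩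
  · obtain ⟨L, hL, hadm, rfl⟩ := hc ht
    refine ⟨hadm.length_le, fun i => ?_, ?_, fun i => hadm.nonempty _ (List.get_mem L i)⟩
    · change (1 : ℤ) ≤ ((L.get i).2 : ℤ)
      exact_mod_cast hL _ (List.get_mem L i)
    · have h := hadm.sum_le
      rw [← List.ofFn_get L, List.map_ofFn, List.sum_ofFn] at h
      change ∑ i : Fin L.length, ((L.get i).2 : ℤ) ≤ _
      exact_mod_cast h
  · obtain ⟨L, -, hadm, rfl⟩ := hc ht
    exact MultPolylog.summable_laTerm_toLaIndex hadm.nonempty ⟨z, hz⟩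
  · convert hsum ⟨z, hz⟩ using 1
    rw [Finsupp.linearCombination_apply, Finsupp.sum, Finsupp.sum, Finset.sum_apply]
    refine Finset.sum_congr rfl fun t _ => ?_
    rw [Algebra.smul_def, Pi.mul_apply, MultPolylog.coeffAlgebra_apply]
    rfl
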